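/- For $n\in\mathbb N$ write $\mathbb R_+^n=\{x\in\mathbb R^n : x_i\ge 0 \text{ for all } i\}$, and consider the following two assertions. $\mathrm{PM}(n)$ (Poincaré–Miranda). Let $a,b\in\mathbb R^n$ with $a_i\le b_i$ for all $i$, let $\mathcal R=[a_1,b_1]\times\cdots\times[a_n,b_n]$, and let $g=(g_1,\dots,g_n):\mathcal R\to\mathbb R^n$ be continuous. Suppose that for each $i\in\{1,\dots,n\}$ one of the following two conditions holds for all $x\in\mathcal R$: (a) $g_i(x)\ge 0$ if $x_i=a_i$, and $g_i(x)\le 0$ if $x_i=b_i$; (b) $g_i(x)\le 0$ if $x_i=a_i$, and $g_i(x)\ge 0$ if $x_i=b_i$. Then there exists $\bar x\in\mathcal R$ with $g(\bar x)=0$. $\mathrm{KP}(n)$ (finite-dimensional Krasnosel'skiĭ–Precup). Let $r,R\in\mathbb R^n$ with $0<r_i<R_i$ for all $i$, let $\overline K_{r,R}=\{x\in\mathbb R_+^n : r_i\le |x_i|\le R_i \text{ for all } i\}$ (that is, the rectangle $[r_1,R_1]\times\cdots\times[r_n,R_n]$), and let $f=(f_1,\dots,f_n):\overline K_{r,R}\to\mathbb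 R_+^n$ be continuous. Suppose that for each $i\in\{1,\dots,n\}$ one of the following two conditions holds for all $x\in\overline K_{r,R}$: (a) $f_i(x)\ge x_i$ if $|x_i|=r_i$, and $f_i(x)\le x_i$ if $|x_i|=R_i$; (b) $f_i(x)\le x_i$ if $|x_i|=r_i$, and $f_i(x)\ge x_i$ if $|x_i|=R_i$. Then $f$ has a fixed point $\bar x\in\overline K_{r,R}$. **Theorem (Poincaré–Miranda).** For every $n$, assertion $\mathrm{PM}(n)$ is true. Moreover, for every $n$, $\mathrm{KP}(n)$ holds if and only if $\mathrm{PM}(n)$ holds. -/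

import Mathlib

/-- The rectangle `[a₁, b₁] × ⋯ × [aₙ, bₙ]` in `ℝⁿ`. -/
def rectangle {n : ℕ} (a b : Fin n → ℝ) : Set (Fin n → ℝ) :=
  Set.univ.pi fun i => Set.Icc (a i) (b i)

/-- The nonnegative cone `ℝ₊ⁿ`. -/
def nonnegCone (n : ℕ) : Set (Fin n → ℝ) :=
  {x | ∀ i, 0 ≤ x i}

/-- The closed conical shell: the points `x` of the cone `ℝ₊ⁿ` with `rᵢ ≤ |xᵢ| ≤ Rᵢ`
for every `i`. -/
def conicalShell {n : ℕ} (r R : Fin n → ℝ) : Set (Fin n → ℝ) :=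
  {x | x ∈ nonnegCone n ∧ ∀ i, r i ≤ |x i| ∧ |x i| ≤ R i}

/-- The assertion of the `n`-dimensional Krasnosel'skii-Precup fixed point theorem in `ℝ₊ⁿ`.
Each component is separately allowed to be of compression type or of expansion type. -/
def KrasnoselskiiPrecup (n : ℕ) : Prop :=
  ∀ (r R : Fin n → ℝ) (f : (Fin n → ℝ) → (Fin n → ℝ)),
    (∀ i, 0 < r i ∧ r i < R i) →
    ContinuousOn f (conicalShell r R) →
    Set.MapsTo f (conicalShell r R) (nonnegCone n) →
    (∀ i,
      (∀ x ∈ conicalShell r R,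
        (|x i| = r i → x i ≤ f x i) ∧ (|x i| = R i → f x i ≤ x i)) ∨
      (∀ x ∈ conicalShell r R,
        (|x i| = r i → f x i ≤ x i) ∧ (|x i| = R i → x i ≤ f x i))) →
    ∃ x ∈ conicalShell r R, f x = x

/-- The assertion of the `n`-dimensional Poincaré-Miranda theorem. -/
def PoincareMiranda (n : ℕ) : Prop :=
  ∀ (a b : Fin n → ℝ) (g : (Fin n → ℝ) → (Fin n → ℝ)),
    (∀ i, a i ≤ b i) →
    ContinuousOn g (rectangle a b) →
    (∀ i,
      (∀ x ∈ rectangle a b, (x i = a i → 0 ≤ g x i) ∧ (x i = b i → g x i ≤ 0)) ∨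
      (∀ x ∈ rectangle a b, (x i = a i → g x i ≤ 0) ∧ (x i = b i → 0 ≤ g x i))) →
    ∃ x ∈ rectangle a b, g x = 0

/-!
The Poincaré–Miranda theorem follows from a form of Brouwer's theorem: if `h : ℝⁿ → ℝⁿ` is
continuous and bounded, then `x + h x = 0` has a solution (`exists_add_eq_zero_of_bounded`).

Brouwer's theorem is proved by an integral argument in the spirit of Milnor and Rogers. Let `h` be
`C¹` with support in a closed ball `B`. For small `t` the map `x ↦ x + t • h x` is a Lipschitz
perturbation of the identity, hence a bijection which fixes every point outside `B`, and it maps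
`B` onto itself; the change of variables formula then gives
`∫_B φ (x + t • h x) * det (1 + t • Dh x) = ∫_B φ x`. If `φ` is a polynomial, so is the left side as
a function of `t`, and therefore the identity holds for `t = 1` too (`setIntegral_pow_mul_det_eq`).
Apply it to `φ y = (1 - |y|² / M) ^ m`. If `x + h x` had no zero, the left side would decay
geometrically in `m` at a strictly faster rate than the right side, whose main contribution comes
from the points near the origin. So a zero exists for `C¹` maps, and by approximation and a cutoff
for continuous bounded ones.

For a rectangle, let `p` be the coordinatewise projection onto it, and normalise the signs so that
`g` points inward on every face. Brouwer's theorem gives `y` with `y - p y = g (p y)`; in each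
coordinate where `y` differs from `p y` the two sides have (weakly) opposite signs, so both sides
vanish and `p y` is a zero of `g`. The same
observation turns a fixed point of a Krasnosel'skiĭ–Precup map built from `p` and a small multiple
of `g` into a zero of `g`. The converse implication is the case `g x = f x - x`.
-/

open MeasureTheory Set Filter Topology Polynomial

/-! ### Invariance of a change-of-variables integral -/

/-- An integral depending polynomially on a parameter, with bounded degree, is constant as soon as
it is constant near `0`: Lagrange interpolation with nodes near `0` expresses its value at any
parameter through its values at the nodes. -/
theorem setIntegral_eval_eq_of_eventually_eq {E : Type*} [MeasurableSpace E] {μ : Measure E}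
    {B : Set E} (P : E → ℝ[X]) (N : ℕ) (hdeg : ∀ x, (P x).natDegree ≤ N)
    (hint : ∀ t, IntegrableOn (fun x => (P x).eval t) B μ) (c : ℝ)
    (hc : ∀ᶠ t in 𝓝 (0 : ℝ), ∫ x in B, (P x).eval t ∂μ = c) (t : ℝ) :
    ∫ x in B, (P x).eval t ∂μ = c := by
  obtain ⟨ε, hε, hball⟩ := Metric.eventually_nhds_iff.1 hc
  set v : ℕ → ℝ := fun j => ε / (j + 2) with hv
  have hvinj : Function.Injective v := by
    intro i j hij
    simp only [hv] at hij
    rw [div_eq_div_iff (by positivity) (by positivity)] at hij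
    have := mul_left_cancel₀ hε.ne' hij
    exact_mod_cast (add_right_cancel this).symm
  have hvc (j : ℕ) : ∫ x in B, (P x).eval (v j) ∂μ = c := by
    apply hball
    have : 0 < v j := by positivity
    rw [Real.dist_eq, sub_zero, abs_of_pos this, hv, div_lt_iff₀ (by positivity)]
    nlinarith [(Nat.cast_nonneg j : (0 : ℝ) ≤ j)]
  set s := Finset.range (N + 1) with hs
  have hexp (Q : ℝ[X]) (hQ : Q.natDegree ≤ N) :
      Q.eval t = ∑ j ∈ s, Q.eval (v j) * (Lagrange.basis s v j).eval t := by
    have hlt : Q.degree < (s.card : WithBot ℕ) := by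
      rw [hs, Finset.card_range]
      exact degree_le_natDegree.trans_lt (by exact_mod_cast Nat.lt_succ_of_le hQ)
    conv_lhs => rw [Lagrange.eq_interpolate (s := s) (v := v) hvinj.injOn hlt]
    simp [Lagrange.interpolate_apply, eval_finsetSum]
  have hone : ∑ j ∈ s, (Lagrange.basis s v j).eval t = 1 := by
    simpa using (hexp 1 (by simp)).symm
  calc ∫ x in B, (P x).eval t ∂μ
      = ∫ x in B, ∑ j ∈ s, (P x).eval (v j) * (Lagrange.basis s v j).eval t ∂μ := by
        congr 1; ext x; exact hexp _ (hdeg x)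
    _ = ∑ j ∈ s, c * (Lagrange.basis s v j).eval t := by
        rw [integral_finsetSum _ fun j _ => (hint (v j)).mul_const _]
        exact Finset.sum_congr rfl fun j _ => by rw [integral_mul_const, hvc]
    _ = c := by rw [← Finset.mul_sum, hone, mul_one]

/-- For small `t` the map `x ↦ x + t • h x` is an orientation-preserving bijection of `B`, so the
change of variables formula applies. -/
theorem eventually_setIntegral_comp_add_smul_eq {E : Type*} [NormedAddCommGroup E]
    [NormedSpace ℝ E] [FiniteDimensional ℝ E] [MeasurableSpace E] [BorelSpace E]
    (μ : Measure E) [μ.IsAddHaarMeasure] {h : E → E} (hh : ContDiff ℝ 1 h)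
    {B : Set E} (hB : IsCompact B) (hsupp : tsupport h ⊆ B) (φ : E → ℝ) :
    ∀ᶠ t in 𝓝 (0 : ℝ),
      ∫ x in B, φ (x + t • h x) * (ContinuousLinearMap.id ℝ E + t • fderiv ℝ h x).det ∂μ =
        ∫ x in B, φ x ∂μ := by
  have hcs : HasCompactSupport h := hB.of_isClosed_subset (isClosed_tsupport h) hsupp
  obtain ⟨K, hK⟩ := hh.lipschitzWith_of_hasCompactSupport hcs one_ne_zero
  have hsmall : ∀ᶠ t : ℝ in 𝓝 0, |t| * (K : ℝ) < 1 := by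
    have : Tendsto (fun t : ℝ => |t| * (K : ℝ)) (𝓝 0) (𝓝 (|0| * (K : ℝ))) := by
      apply Continuous.tendsto; fun_prop
    exact this.eventually_lt_const (by simp)
  -- The determinant equals `1` at `t = 0`, so by compactness it stays positive on `B`.
  have hdet : ∀ᶠ t in 𝓝 (0 : ℝ), ∀ x ∈ B,
      0 < (ContinuousLinearMap.id ℝ E + t • fderiv ℝ h x).det := by
    apply hB.eventually_forall_of_forall_eventually
    intro y _
    have hcont : Continuous fun z : ℝ × E =>
        (ContinuousLinearMap.id ℝ E + z.1 • fderiv ℝ h z.2).det := by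
      have := hh.continuous_fderiv one_ne_zero
      exact ContinuousLinearMap.continuous_det.comp (by fun_prop)
    apply hcont.continuousAt.eventually_const_lt
    simp [ContinuousLinearMap.det]
  filter_upwards [hsmall, hdet] with t ht hpos
  set F : E → E := fun x => x + t • h x with hF
  have happ : ApproximatesLinearOn F ((ContinuousLinearEquiv.refl ℝ E : E ≃L[ℝ] E) : E →L[ℝ] E)
      univ (‖t‖₊ * K) := by
    intro x _ y _
    have : F x - F y - (x - y) = t • (h x - h y) := by simp only [hF]; module
    simp only [ContinuousLinearEquiv.coe_refl, ContinuousLinearMap.coe_id', id_eq, this,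
      norm_smul, NNReal.coe_mul, coe_nnnorm, mul_assoc]
    gcongr
    simpa [dist_eq_norm] using hK.dist_le_mul x y
  have hN : Subsingleton E ∨ ‖t‖₊ * K <
      ‖((ContinuousLinearEquiv.refl ℝ E).symm : E →L[ℝ] E)‖₊⁻¹ := by
    rcases subsingleton_or_nontrivial E with hE | hE
    · exact Or.inl hE
    · right
      have : ‖((ContinuousLinearEquiv.refl ℝ E).symm : E →L[ℝ] E)‖₊ = 1 := by
        ext; simp
      rw [this, inv_one, ← NNReal.coe_lt_coe]
      simpa using ht
  have hbij : Function.Bijective F := (happ.toHomeomorph F hN).bijective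
  have hout : ∀ x ∉ B, F x = x := fun x hx => by
    simp [hF, image_eq_zero_of_notMem_tsupport fun hx' => hx (hsupp hx')]
  -- A bijection that fixes the complement of `B` pointwise maps `B` onto `B`.
  have himage : F '' B = B := by
    have : F '' Bᶜ = Bᶜ := by
      conv_rhs => rw [← image_id Bᶜ]
      exact image_congr hout
    rw [image_compl_eq hbij] at this
    exact compl_injective this
  have hder (x : E) : HasFDerivAt F (ContinuousLinearMap.id ℝ E + t • fderiv ℝ h x) x :=
    (hasFDerivAt_id x).add ((hh.differentiable one_ne_zero x).hasFDerivAt.const_smul t)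
  have hcv := integral_image_eq_integral_abs_det_fderiv_smul μ hB.measurableSet
    (fun x _ => (hder x).hasFDerivWithinAt) hbij.injective.injOn φ
  rw [himage] at hcv
  rw [hcv]
  refine setIntegral_congr_fun hB.measurableSet fun x hx => ?_
  simp only [abs_of_pos (hpos x hx), smul_eq_mul, hF]
  ring

theorem exists_polynomial_eval_eq_det_id_add_smul {n : ℕ}
    (A : (Fin n → ℝ) →L[ℝ] (Fin n → ℝ)) :
    ∃ D : ℝ[X], D.natDegree ≤ n ∧
      ∀ t, D.eval t = (ContinuousLinearMap.id ℝ (Fin n → ℝ) + t • A).det := by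
  refine ⟨_, (natDegree_det_X_add_C_le (LinearMap.toMatrix' (A : (Fin n → ℝ) →ₗ[ℝ] (Fin n → ℝ)))
    1).trans_eq (Fintype.card_fin n), fun t => ?_⟩
  rw [ContinuousLinearMap.det, ← LinearMap.det_toMatrix', ← coe_evalRingHom, RingHom.map_det]
  congr 1
  ext i j
  by_cases hij : i = j <;> simp [LinearMap.toMatrix'_apply, hij] <;> ring

theorem exists_polynomial_eval_eq_pow {n : ℕ} (M : ℝ) (m : ℕ) (x y : Fin n → ℝ) :
    ∃ Q : ℝ[X], Q.natDegree ≤ 2 * m ∧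
      ∀ t, Q.eval t = (1 - (∑ i, (x + t • y) i ^ 2) / M) ^ m := by
  refine ⟨(1 - C M⁻¹ * ∑ i, (C (x i) + X * C (y i)) ^ 2) ^ m, ?_, fun t => ?_⟩
  · refine natDegree_pow_le.trans ?_
    rw [mul_comm]
    refine Nat.mul_le_mul_right _ ((natDegree_sub_le _ _).trans (max_le (by simp) ?_))
    refine (natDegree_C_mul_le _ _).trans (natDegree_sum_le_of_forall_le _ _ fun i _ => ?_)
    compute_degree
  · simp [eval_finsetSum, div_eq_inv_mul, mul_comm t]

/-- The change of variables formula for `x ↦ x + h x`, which need not be injective: both sides of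
the formula for `x ↦ x + t • h x` are polynomial in `t`, and they agree for small `t`. Only
test functions that are powers of `1 - |y|² / M` are needed. -/
theorem setIntegral_pow_mul_det_eq {n : ℕ} {h : (Fin n → ℝ) → (Fin n → ℝ)}
    (hh : ContDiff ℝ 1 h) {B : Set (Fin n → ℝ)} (hB : IsCompact B) (hsupp : tsupport h ⊆ B)
    (M : ℝ) (m : ℕ) :
    ∫ x in B, (1 - (∑ i, (x + h x) i ^ 2) / M) ^ m *
        (ContinuousLinearMap.id ℝ (Fin n → ℝ) + fderiv ℝ h x).det =
      ∫ x in B, (1 - (∑ i, x i ^ 2) / M) ^ m := by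
  choose D hDdeg hD using fun x => exists_polynomial_eval_eq_det_id_add_smul (fderiv ℝ h x)
  choose Q hQdeg hQ using fun x => exists_polynomial_eval_eq_pow M m x (h x)
  have heval (x : Fin n → ℝ) (t : ℝ) : (Q x * D x).eval t =
      (1 - (∑ i, (x + t • h x) i ^ 2) / M) ^ m *
        (ContinuousLinearMap.id ℝ (Fin n → ℝ) + t • fderiv ℝ h x).det := by
    rw [eval_mul, hQ, hD]
  have key := setIntegral_eval_eq_of_eventually_eq (μ := volume) (B := B)
    (fun x => Q x * D x) (2 * m + n)
    (fun x => natDegree_mul_le.trans (add_le_add (hQdeg x) (hDdeg x))) ?_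
    (∫ x in B, (1 - (∑ i, x i ^ 2) / M) ^ m) ?_ 1
  · simpa only [heval, one_smul] using key
  · intro t
    simp only [heval]
    refine ContinuousOn.integrableOn_compact hB (Continuous.continuousOn ?_)
    have h1 := hh.continuous
    have h2 := hh.continuous_fderiv one_ne_zero
    have h3 : Continuous fun x => (ContinuousLinearMap.id ℝ (Fin n → ℝ) + t • fderiv ℝ h x).det :=
      ContinuousLinearMap.continuous_det.comp (by fun_prop)
    fun_prop
  · simp only [heval]
    exact eventually_setIntegral_comp_add_smul_eq volume hh hB hsupp
      fun y => (1 - (∑ i, y i ^ 2) / M) ^ m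

/-! ### Brouwer's theorem for perturbations of the identity -/

theorem exists_add_eq_zero_of_contDiff {n : ℕ} {h : (Fin n → ℝ) → (Fin n → ℝ)}
    (hh : ContDiff ℝ 1 h) (hcs : HasCompactSupport h) : ∃ x, x + h x = 0 := by
  by_contra! hne
  obtain ⟨ρ, hρ, hsupp⟩ : ∃ ρ > 0, tsupport h ⊆ Metric.closedBall 0 ρ := by
    obtain ⟨ρ, hρ⟩ := hcs.isBounded.subset_closedBall 0
    exact ⟨max ρ 1, by positivity, hρ.trans (Metric.closedBall_subset_closedBall (le_max_left _ _))⟩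
  set B := Metric.closedBall (0 : Fin n → ℝ) ρ with hBdef
  have hB : IsCompact B := isCompact_closedBall _ _
  have hBne : B.Nonempty := ⟨0, by simp [hBdef, hρ.le]⟩
  set q : (Fin n → ℝ) → ℝ := fun y => ∑ i, y i ^ 2 with hq
  have hqc : Continuous q := by fun_prop
  have hq0 (y) : 0 ≤ q y := Finset.sum_nonneg fun i _ => sq_nonneg _
  have hqpos (y) (hy : y ≠ 0) : 0 < q y := by
    refine (hq0 y).lt_of_ne fun h0 => hy ?_
    ext i
    have := (Finset.sum_eq_zero_iff_of_nonneg fun i _ => sq_nonneg (y i)).1 h0.symm i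
      (Finset.mem_univ i)
    simpa using this
  have hhc := hh.continuous
  have hqF : Continuous fun x => q (x + h x) := by fun_prop
  obtain ⟨x₀, -, hx₀⟩ := hB.exists_isMinOn hBne hqF.continuousOn
  set δ := q (x₀ + h x₀) with hδdef
  have hδ : 0 < δ := hqpos _ (hne x₀)
  obtain ⟨M₁, hM₁⟩ := hB.bddAbove_image hqF.continuousOn
  obtain ⟨M₂, hM₂⟩ := hB.bddAbove_image hqc.continuousOn
  set M := max (max M₁ M₂) δ with hM
  have hMpos : 0 < M := hδ.trans_le (le_max_right _ _)
  have hM1 (x) (hx : x ∈ B) : q (x + h x) ≤ M :=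
    (hM₁ ⟨x, hx, rfl⟩).trans ((le_max_left _ _).trans (le_max_left _ _))
  have hM2 (x) (hx : x ∈ B) : q x ≤ M :=
    (hM₂ ⟨x, hx, rfl⟩).trans ((le_max_right _ _).trans (le_max_left _ _))
  have hJ : Continuous fun x => (ContinuousLinearMap.id ℝ (Fin n → ℝ) + fderiv ℝ h x).det := by
    have := hh.continuous_fderiv one_ne_zero
    exact ContinuousLinearMap.continuous_det.comp (by fun_prop)
  obtain ⟨J, hJb⟩ := hB.exists_bound_of_continuousOn hJ.continuousOn
  set α := 1 - δ / M with hα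
  set β := 1 - δ / 2 / M with hβ
  have hδM : δ / M ≤ 1 := (div_le_one hMpos).2 (le_max_right _ _)
  have hα0 : 0 ≤ α := by linarith
  have hαβ : α < β := by
    have : δ / 2 / M < δ / M := by gcongr; linarith
    linarith
  have hβ0 : 0 < β := hα0.trans_lt hαβ
  -- `1 - |x + h x|² / M` is at most `α` on `B`, while `1 - |x|² / M` is at least `β > α` near `0`.
  have hupper (m : ℕ) : ∫ x in B, (1 - q x / M) ^ m ≤ α ^ m * (J * volume.real B) := by
    rw [← setIntegral_pow_mul_det_eq hh hB hsupp M m]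
    refine (le_abs_self _).trans ?_
    rw [← Real.norm_eq_abs, ← mul_assoc]
    refine norm_setIntegral_le_of_norm_le_const hB.measure_lt_top fun x hx => ?_
    rw [norm_mul, norm_pow]
    have h1 : q (x + h x) / M ≤ 1 := (div_le_one hMpos).2 (hM1 x hx)
    have h2 : δ / M ≤ q (x + h x) / M := by gcongr; exact hx₀ hx
    gcongr
    · rw [Real.norm_eq_abs, abs_of_nonneg (by linarith)]
      linarith
    · exact hJb x hx
  set U := Metric.ball (0 : Fin n → ℝ) ρ ∩ {x | q x < δ / 2} with hU
  have hUo : IsOpen U := Metric.isOpen_ball.inter (isOpen_lt hqc continuous_const)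
  have hUB : U ⊆ B := inter_subset_left.trans Metric.ball_subset_closedBall
  have hUfin : volume U < ⊤ := (measure_mono hUB).trans_lt hB.measure_lt_top
  have hUpos : 0 < volume.real U :=
    ENNReal.toReal_pos (hUo.measure_pos _ ⟨0, by simp [hU, hρ, hq, hδ]⟩).ne' hUfin.ne
  have hlower (m : ℕ) : β ^ m * volume.real U ≤ ∫ x in B, (1 - q x / M) ^ m := by
    have hint : IntegrableOn (fun x => (1 - q x / M) ^ m) B :=
      ContinuousOn.integrableOn_compact hB (by fun_prop)
    calc β ^ m * volume.real U = ∫ x in U, β ^ m := by simp [mul_comm]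
      _ ≤ ∫ x in U, (1 - q x / M) ^ m := by
        refine setIntegral_mono_on (integrableOn_const hUfin.ne) (hint.mono_set hUB)
          hUo.measurableSet fun x hx => ?_
        have : q x / M ≤ δ / 2 / M := by gcongr; exact hx.2.le
        gcongr
        linarith
      _ ≤ ∫ x in B, (1 - q x / M) ^ m := by
        refine setIntegral_mono_set hint ?_ hUB.eventuallyLE
        filter_upwards [ae_restrict_mem hB.measurableSet] with x hx
        have : q x / M ≤ 1 := (div_le_one hMpos).2 (hM2 x hx)
        exact pow_nonneg (by linarith) m
  have hlim : Tendsto (fun m : ℕ => (α / β) ^ m * (J * volume.real B)) atTop (𝓝 0) := by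
    simpa using (tendsto_pow_atTop_nhds_zero_of_lt_one (div_nonneg hα0 hβ0.le)
      ((div_lt_one hβ0).2 hαβ)).mul_const (J * volume.real B)
  obtain ⟨m, hm⟩ := (hlim.eventually_lt_const hUpos).exists
  have := (hlower m).trans (hupper m)
  rw [div_pow, div_mul_eq_mul_div, div_lt_iff₀ (pow_pos hβ0 m)] at hm
  linarith

theorem exists_add_eq_zero_of_hasCompactSupport {n : ℕ} {h : (Fin n → ℝ) → (Fin n → ℝ)}
    (hh : Continuous h) (hcs : HasCompactSupport h) : ∃ x, x + h x = 0 := by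
  by_contra! hne
  have hF : Continuous fun x => ‖x + h x‖ := by fun_prop
  obtain ⟨x₀, -, hx₀⟩ := (hcs.isCompact.insert 0).exists_isMinOn (insert_nonempty _ _)
    hF.continuousOn
  obtain ⟨g, hg, hgh, hsupp⟩ := hh.exists_contDiff_approx 1
    (continuous_const (y := ‖x₀ + h x₀‖)) fun _ => norm_pos_iff.2 (hne x₀)
  obtain ⟨x, hx⟩ := exists_add_eq_zero_of_contDiff hg (hcs.mono hsupp)
  -- Off the support of `g` the equation reads `x = 0`; hence `0` was included in the compact set.
  have hmem : x ∈ insert 0 (tsupport h) := by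
    by_cases hxg : g x = 0
    · exact Or.inl (by simpa [hxg] using hx)
    · exact Or.inr (subset_tsupport h (hsupp hxg))
  have hlt := hgh x
  rw [dist_comm, dist_eq_norm, ← add_sub_add_left_eq_sub (h x) (g x) x, hx, sub_zero] at hlt
  exact (hx₀ hmem).not_gt hlt

/-- Brouwer's theorem: a bounded continuous perturbation of the identity has a zero. -/
theorem exists_add_eq_zero_of_bounded {n : ℕ} {h : (Fin n → ℝ) → (Fin n → ℝ)}
    (hh : Continuous h) {M : ℝ} (hM : ∀ x, ‖h x‖ ≤ M) : ∃ x, x + h x = 0 := by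
  set χ : (Fin n → ℝ) → ℝ := fun x => max 0 (min 1 (M + 1 - ‖x‖)) with hχ
  have hχc : Continuous χ := by fun_prop
  have hcs : HasCompactSupport fun x => χ x • h x := by
    refine HasCompactSupport.intro (isCompact_closedBall 0 (M + 1)) fun x hx => ?_
    have hx' : M + 1 < ‖x‖ := by simpa using hx
    have : χ x = 0 := max_eq_left ((min_le_right _ _).trans (by linarith))
    simp [this]
  obtain ⟨x, hx⟩ := exists_add_eq_zero_of_hasCompactSupport (hχc.smul hh) hcs
  have hxM : ‖x‖ ≤ M := by
    have h0 : 0 ≤ χ x := le_max_left _ _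
    have h1 : χ x ≤ 1 := max_le zero_le_one (min_le_left _ _)
    rw [eq_neg_of_add_eq_zero_left hx, norm_neg, Pi.smul_apply', norm_smul, Real.norm_eq_abs,
      abs_of_nonneg h0]
    exact (mul_le_of_le_one_left (norm_nonneg _) h1).trans (hM x)
  have hone : χ x = 1 := by
    simp only [hχ]
    rw [min_eq_left (by linarith), max_eq_right zero_le_one]
  exact ⟨x, by simpa [hone] using hx⟩

/-! ### Rectangles and inward-pointing maps -/

/-- The coordinatewise nearest-point projection onto `rectangle a b`, for `a ≤ b`. -/
def clampRectangle {n : ℕ} (a b : Fin n → ℝ) (y : Fin n → ℝ) : Fin n → ℝ :=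
  fun i => max (a i) (min (b i) (y i))

theorem continuous_clampRectangle {n : ℕ} (a b : Fin n → ℝ) :
    Continuous (clampRectangle a b) := by
  unfold clampRectangle
  fun_prop

theorem clampRectangle_mem {n : ℕ} {a b : Fin n → ℝ} (hab : ∀ i, a i ≤ b i) (y : Fin n → ℝ) :
    clampRectangle a b y ∈ rectangle a b :=
  fun i _ => ⟨le_max_left _ _, max_le (hab i) (min_le_left _ _)⟩

theorem isCompact_rectangle {n : ℕ} (a b : Fin n → ℝ) : IsCompact (rectangle a b) :=
  isCompact_univ_pi fun _ => isCompact_Icc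

/-- The map `g` points into `rectangle a b` at each of its faces, in the weak sense. In a
degenerate direction, where `a i = b i`, this forces `g x i = 0`. -/
def PointsInward {n : ℕ} (a b : Fin n → ℝ) (g : (Fin n → ℝ) → (Fin n → ℝ)) : Prop :=
  ∀ i, ∀ x ∈ rectangle a b, (x i = a i → 0 ≤ g x i) ∧ (x i = b i → g x i ≤ 0)

/-- Outside the rectangle, `y` minus its projection points strictly outward in some coordinate, so
it cannot be a positive multiple of an inward-pointing map at the projection. -/
theorem PointsInward.eq_zero_of_sub_clampRectangle_eq_smul {n : ℕ} {a b : Fin n → ℝ}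
    {g : (Fin n → ℝ) → (Fin n → ℝ)} (hg : PointsInward a b g) (hab : ∀ i, a i ≤ b i)
    {ε : ℝ} (hε : 0 < ε) {y : Fin n → ℝ}
    (hy : y - clampRectangle a b y = ε • g (clampRectangle a b y)) :
    g (clampRectangle a b y) = 0 := by
  ext i
  obtain ⟨hga, hgb⟩ := hg i _ (clampRectangle_mem hab y)
  have hyi : y i - clampRectangle a b y i = ε * g (clampRectangle a b y) i := congrFun hy i
  have hi : clampRectangle a b y i = max (a i) (min (b i) (y i)) := rfl
  rcases lt_or_ge (y i) (a i) with h | h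
  · have hc : clampRectangle a b y i = a i := by
      rw [hi, max_eq_left ((min_le_right _ _).trans h.le)]
    nlinarith [hga hc]
  rcases lt_or_ge (b i) (y i) with h' | h'
  · have hc : clampRectangle a b y i = b i := by
      rw [hi, min_eq_left h'.le, max_eq_right (hab i)]
    nlinarith [hgb hc]
  · rw [hi, min_eq_right h', max_eq_right h, sub_self] at hyi
    exact (mul_eq_zero.1 hyi.symm).resolve_left hε.ne'

/-- Multiplying components of `g` by `-1` turns the boundary condition of each component into
the inward-pointing one and keeps the zeros. -/
theorem poincareMiranda_of_pointsInward {n : ℕ}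
    (H : ∀ (a b : Fin n → ℝ) (g : (Fin n → ℝ) → (Fin n → ℝ)), (∀ i, a i ≤ b i) →
      ContinuousOn g (rectangle a b) → PointsInward a b g → ∃ x ∈ rectangle a b, g x = 0) :
    PoincareMiranda n := by
  intro a b g hab hg hcond
  have hsign (i : Fin n) : ∃ s : ℝ, s ≠ 0 ∧ ∀ x ∈ rectangle a b,
      (x i = a i → 0 ≤ s * g x i) ∧ (x i = b i → s * g x i ≤ 0) := by
    rcases hcond i with h | h
    · exact ⟨1, one_ne_zero, by simpa using h⟩
    · exact ⟨-1, by norm_num, by simpa using h⟩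
  choose s hs0 hs using hsign
  obtain ⟨x, hx, hgx⟩ := H a b (fun x i => s i * g x i) hab
    (continuousOn_pi.2 fun i => continuousOn_const.mul (continuousOn_pi.1 hg i)) hs
  exact ⟨x, hx, funext fun i => (mul_eq_zero.1 (congrFun hgx i)).resolve_left (hs0 i)⟩

/-! ### The Poincaré–Miranda theorem and its Krasnosel'skiĭ–Precup form -/

theorem poincareMiranda (n : ℕ) : PoincareMiranda n := by
  refine poincareMiranda_of_pointsInward fun a b g hab hg hin => ?_
  have hmem := clampRectangle_mem hab
  have hc := continuous_clampRectangle a b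
  obtain ⟨M, hM⟩ := (isCompact_rectangle a b).exists_bound_of_continuousOn
    (continuousOn_id.add hg)
  obtain ⟨y, hy⟩ := exists_add_eq_zero_of_bounded
    (h := fun y => -(clampRectangle a b y + g (clampRectangle a b y)))
    (hc.add (hg.comp_continuous hc hmem)).neg
    (fun y => (norm_neg _).trans_le (hM _ (hmem y)))
  refine ⟨_, hmem y, hin.eq_zero_of_sub_clampRectangle_eq_smul hab one_pos ?_⟩
  exact (sub_eq_iff_eq_add'.2 (eq_of_sub_eq_zero ((sub_eq_add_neg _ _).trans hy))).trans
    (one_smul ℝ _).symm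

theorem conicalShell_eq_rectangle {n : ℕ} {r R : Fin n → ℝ} (hr : ∀ i, 0 < r i) :
    conicalShell r R = rectangle r R := by
  ext x
  constructor
  · rintro ⟨hx, h⟩ i -
    simpa [abs_of_nonneg (hx i)] using h i
  · intro hx
    have h0 (i) : 0 ≤ x i := (hr i).le.trans (hx i trivial).1
    exact ⟨h0, fun i => by simpa [abs_of_nonneg (h0 i)] using hx i trivial⟩

theorem PoincareMiranda.krasnoselskiiPrecup {n : ℕ} (H : PoincareMiranda n) :
    KrasnoselskiiPrecup n := by
  intro r R f hrR hf hmaps hcond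
  have hshell := conicalShell_eq_rectangle (R := R) fun i => (hrR i).1
  have habs {x : Fin n → ℝ} (hx : x ∈ rectangle r R) (i : Fin n) : |x i| = x i :=
    abs_of_nonneg ((hrR i).1.le.trans (hx i trivial).1)
  rw [hshell] at hf hcond ⊢
  obtain ⟨x, hx, hfx⟩ := H r R (fun x => f x - x) (fun i => (hrR i).2.le)
    (hf.sub continuousOn_id) fun i => (hcond i).imp
      (fun h x hx => by simpa [habs hx i] using h x hx)
      (fun h x hx => by simpa [habs hx i] using h x hx)
  exact ⟨x, hx, sub_eq_zero.1 hfx⟩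

/-- The rectangle is translated to have lower corner `1`, which lies in the interior of the cone,
and its upper faces are moved out by `1`, so that the larger rectangle is nondegenerate even when
`a i = b i`. On it, `clampRectangle a b + ε • g ∘ clampRectangle a b` is of compression type in
every component. -/
theorem KrasnoselskiiPrecup.poincareMiranda {n : ℕ} (H : KrasnoselskiiPrecup n) :
    PoincareMiranda n := by
  refine poincareMiranda_of_pointsInward fun a b g hab hg hin => ?_
  have hmem := clampRectangle_mem hab
  have hc := continuous_clampRectangle a b
  obtain ⟨M, hM⟩ := (isCompact_rectangle a b).exists_bound_of_continuousOn hg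
  have hM0 : 0 ≤ M := (norm_nonneg _).trans (hM _ (hmem 0))
  -- With this `ε`, the perturbation `ε • g` has components at most `1` in absolute value, so that
  -- the map `f` below takes values in the cone.
  set ε : ℝ := (M + 1)⁻¹ with hε
  have hε0 : 0 < ε := by positivity
  have hεg (y : Fin n → ℝ) (i : Fin n) : |ε * g (clampRectangle a b y) i| ≤ 1 := by
    rw [abs_mul, abs_of_pos hε0, hε, inv_mul_le_iff₀ (by positivity), mul_one]
    exact ((norm_le_pi_norm _ i).trans (hM _ (hmem y))).trans (by linarith)
  -- `σ` translates the enlarged rectangle with lower corner `1` to one with lower corner `a`.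
  set σ : (Fin n → ℝ) → (Fin n → ℝ) := fun x => x + (a - 1) with hσ
  have hgc : Continuous fun x => g (clampRectangle a b (σ x)) :=
    hg.comp_continuous (by fun_prop) fun x => hmem _
  set f : (Fin n → ℝ) → (Fin n → ℝ) := fun x =>
    clampRectangle a b (σ x) - (a - 1) + ε • g (clampRectangle a b (σ x)) with hf
  have hfi (x : Fin n → ℝ) (i : Fin n) : f x i = max (a i) (min (b i) (x i + (a i - 1))) -
      (a i - 1) + ε * g (clampRectangle a b (σ x)) i := rfl
  have hfc : Continuous f :=
    ((hc.comp (by fun_prop)).sub continuous_const).add (hgc.const_smul ε)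
  have hmaps : MapsTo f (conicalShell 1 (b - a + 2)) (nonnegCone n) := by
    intro x _ i
    have h1 := (abs_le.1 (hεg (σ x) i)).1
    have h2 := le_max_left (a i) (min (b i) (x i + (a i - 1)))
    rw [hfi]
    linarith
  have hcompr (i : Fin n) (x : Fin n → ℝ) (hx : x ∈ conicalShell 1 (b - a + 2)) :
      (|x i| = 1 → x i ≤ f x i) ∧ (|x i| = b i - a i + 2 → f x i ≤ x i) := by
    obtain ⟨hga, hgb⟩ := hin i _ (hmem (σ x))
    rw [abs_of_nonneg (hx.1 i), hfi]
    have habi := hab i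
    have hci : clampRectangle a b (σ x) i = max (a i) (min (b i) (x i + (a i - 1))) := rfl
    constructor <;> intro hxi
    · have h1 : max (a i) (min (b i) (x i + (a i - 1))) = a i :=
        max_eq_left ((min_le_right _ _).trans (by linarith))
      have := mul_nonneg hε0.le (hga (hci.trans h1))
      linarith
    · have h1 : max (a i) (min (b i) (x i + (a i - 1))) = b i := by
        rw [min_eq_left (by linarith), max_eq_right habi]
      have := mul_nonpos_of_nonneg_of_nonpos hε0.le (hgb (hci.trans h1))
      linarith
  have hrR (i : Fin n) : (0 : ℝ) < 1 ∧ (1 : ℝ) < b i - a i + 2 :=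
    ⟨one_pos, by linarith [hab i]⟩
  obtain ⟨x, -, hx⟩ := H 1 (b - a + 2) f hrR hfc.continuousOn hmaps fun i => Or.inl (hcompr i)
  refine ⟨_, hmem (σ x), hin.eq_zero_of_sub_clampRectangle_eq_smul hab hε0 ?_⟩
  calc σ x - clampRectangle a b (σ x)
      = f x + (a - 1) - clampRectangle a b (σ x) := by rw [hx]
    _ = ε • g (clampRectangle a b (σ x)) := by simp only [hf]; abel

theorem mainTheorem8 (n : ℕ) :
    PoincareMiranda n ∧ (KrasnoselskiiPrecup n ↔ PoincareMiranda n) :=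
  ⟨poincareMiranda n, KrasnoselskiiPrecup.poincareMiranda, PoincareMiranda.krasnoselskiiPrecup⟩
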